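/- Let $\sigma$ be a substitution (a morphism of the free monoid $\{a,b\}^*$) that is well-marked, i.e. $\sigma(a)$ begins with $a$ and $\sigma(b)$ begins with $b$, and primitive, i.e. some positive power of its incidence matrix $(|\sigma(y)|_x)_{x,y\in\{a,b\}}$ has only positive entries. Let $\xi=\xi_1\xi_2\cdots$ be an infinite word with $\sigma(\xi)=\xi$ that is not ultimately periodic. Write $p(n)$ for the number of factors of $\xi$ of length $n$. A word $W$ is special if $Wa$ and $Wb$ are factors of $\xi$; a special word $W$ is strong if $aW$ and $bW$ are both special, and weak if neither of them is special. Let $s(n)$ be the number of special words of length $n$. Let $W_0$ be the longest common suffix of the left-infinite words $\cdots\sigma(a)\sigma(a)$ and $\cdots\sigma(b)\sigma(b)$, and put $T(W)=W_0\sigma(W)$ for words $W$. Let $E_1=\{|\sigma(\xi_1\cdots\xi_{k-1})|+1 : k\ge 1\}$ be the set of cutting positions of $\xi$. An integer $C\ge 0$ is called a recognizability constant for $\xi$ if, for all positions $i,j>C$, the conditions $\xi_{i-C}\cdots\xi_{i+C}=\xi_{j-C}\cdots\xi_{j+C}$ and $i\in E_1$ imply $j\in E_1$. For such $C$ put $$L=\max\{2C+\max\{|\sigma(a)|,|\sigma(b)|\},\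 |\sigma(a)|+|\sigma(b)|-1\}.$$ Let $\overline{\mathcal S}$ be the finite set of special words $W$ with $1\le |W|\le L$, and let $\widetilde{\mathcal S^2}$ (resp. $\widetilde{\mathcal S^0}$) be the set of strong (resp. weak) words $W\in\overline{\mathcal S}$ with $|T(W)|>L$. Put $\operatorname{sgn}(W)=1$ if $W\in\widetilde{\mathcal S^2}$, $\operatorname{sgn}(W)=-1$ if $W\in\widetilde{\mathcal S^0}$, and $\operatorname{sgn}(W)=0$ otherwise. Let $\delta$ be the Kronecker symbol. Then there is an integer $C\ge 0$, depending only on $\sigma$, that is a recognizability constant for every fixed point of $\sigma$ that is not ultimately periodic. Moreover $s(n)=p(n+1)-p(n)$ for all $n\ge 0$, and for every recognizability constant $C$ for $\xi$, with $L$ and the sets above defined from $C$, and every $n>L$, each $W\in\overline{\mathcal S}$ satisfies $|T^k(W)|=n$ for only finitely many $k\ge 1$, and $$s(n+1)-s(n)=\sum_{W\in\widetilde{\mathcal S^2}}\sum_{k\ge 1}\delta(|T^k(W)|,n)-\sum_{W\in\widetilde{\mathcal S^0}}\sum_{k\ge 1}\delta(|T^k(W)|,n)=\sum_{W\in\overline{\mathcal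 S}}\sum_{k\ge 1}\operatorname{sgn}(W)\,\delta(|T^k(W)|,n).$$ -/

import Mathlib

namespace BinarySubst

/-- The binary alphabet: `false` is the letter `a`, `true` is the letter `b`. -/
abbrev Letter := Bool

/-- Finite words, i.e. the elements of the free monoid on the two letters. -/
abbrev Word := List Letter

/-- A substitution, given by the images of the two letters. -/
abbrev Substitution := Letter → Word

/-- The morphism of the free monoid that extends `σ`. -/
def applyWord (σ : Substitution) (W : Word) : Word := W.flatMap σ

/-- `σ(a)` begins with `a` and `σ(b)` begins with `b`. In particular `σ` is non-erasing. -/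
def IsWellMarked (σ : Substitution) : Prop := ∀ x : Letter, ∃ u : Word, σ x = x :: u

/-- The incidence matrix; its column `j` is the Parikh vector of `σ(j)`. -/
def incidenceMatrix (σ : Substitution) : Matrix Letter Letter ℤ :=
  Matrix.of fun i j => ((σ j).count i : ℤ)

/-- Some positive power of the incidence matrix has only positive entries. -/
def IsPrimitive (σ : Substitution) : Prop := (incidenceMatrix σ).IsPrimitive

/-- The factor of length `n` of the infinite word `ξ` that starts at position `i`
(positions are counted from `0`). -/
def factorAt (ξ : ℕ → Letter) (i n : ℕ) : Word := List.ofFn fun t : Fin n => ξ (i + t)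

/-- `W` occurs in `ξ`. -/
def IsFactor (ξ : ℕ → Letter) (W : Word) : Prop := ∃ i : ℕ, factorAt ξ i W.length = W

/-- `σ(ξ) = ξ`: the images under `σ` of the prefixes of `ξ` are prefixes of `ξ`.
For non-erasing `σ` their lengths are unbounded, so that they determine the infinite
word `σ(ξ)`. -/
def IsFixedPoint (σ : Substitution) (ξ : ℕ → Letter) : Prop :=
  ∀ k : ℕ, applyWord σ (factorAt ξ 0 k) = factorAt ξ 0 (applyWord σ (factorAt ξ 0 k)).length

/-- `ξ` is ultimately periodic. -/
def IsUltimatelyPeriodic (ξ : ℕ → Letter) : Prop :=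
  ∃ N p : ℕ, 0 < p ∧ ∀ i : ℕ, N ≤ i → ξ (i + p) = ξ i

/-- The complexity `p(n)` of `ξ`: the number of factors of length `n`. -/
noncomputable def complexity (ξ : ℕ → Letter) (n : ℕ) : ℕ :=
  {W : Word | W.length = n ∧ IsFactor ξ W}.ncard

/-- (Right) special words: both right extensions are factors of `ξ`. -/
def IsSpecial (ξ : ℕ → Letter) (W : Word) : Prop := ∀ x : Letter, IsFactor ξ (W ++ [x])

/-- Strong special words: both left prolongations are special. -/
def IsStrongSpecial (ξ : ℕ → Letter) (W : Word) : Prop :=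
  IsSpecial ξ W ∧ ∀ x : Letter, IsSpecial ξ (x :: W)

/-- Weak special words: neither left prolongation is special. -/
def IsWeakSpecial (ξ : ℕ → Letter) (W : Word) : Prop :=
  IsSpecial ξ W ∧ ∀ x : Letter, ¬ IsSpecial ξ (x :: W)

/-- `s(n)`, the number of special words of length `n`. -/
noncomputable def specialCount (ξ : ℕ → Letter) (n : ℕ) : ℕ :=
  {W : Word | W.length = n ∧ IsSpecial ξ W}.ncard

/-- The letter at distance `i` from the right end of the left-infinite word `⋯AAA`
(for non-empty `A`). -/
def leftPower (A : Word) (i : ℕ) : Letter := A.reverse.getD (i % A.length) false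

/-- The length of the longest common suffix of `⋯σ(a)σ(a)` and `⋯σ(b)σ(b)`. -/
noncomputable def lengthW0 (σ : Substitution) : ℕ :=
  sInf {i : ℕ | leftPower (σ false) i ≠ leftPower (σ true) i}

/-- The longest common suffix `W₀` of `⋯σ(a)σ(a)` and `⋯σ(b)σ(b)`. -/
noncomputable def wordW0 (σ : Substitution) : Word :=
  (List.ofFn fun i : Fin (lengthW0 σ) => leftPower (σ false) i).reverse

/-- The operator `T(W) = W₀ σ(W)`. -/
noncomputable def opT (σ : Substitution) (W : Word) : Word := wordW0 σ ++ applyWord σ W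

/-- The cutting positions of the decomposition `ξ = σ(ξ₀)σ(ξ₁)σ(ξ₂)⋯`. -/
def cuttingPositions (σ : Substitution) (ξ : ℕ → Letter) : Set ℕ :=
  {n : ℕ | ∃ k : ℕ, n = (applyWord σ (factorAt ξ 0 k)).length}

/-- `C` is a recognizability constant: whenever the windows of radius `C` around two positions
of `ξ` (here `i + C` and `j + C`) carry the same word and the first position is a cutting
position, then so is the second. -/
def IsRecognizabilityConstant (σ : Substitution) (ξ : ℕ → Letter) (C : ℕ) : Prop :=
  ∀ i j : ℕ, factorAt ξ i (2 * C + 1) = factorAt ξ j (2 * C + 1) →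
    i + C ∈ cuttingPositions σ ξ → j + C ∈ cuttingPositions σ ξ

/-- The threshold `L = max {2C + max {|σ(a)|, |σ(b)|}, |σ(a)| + |σ(b)| - 1}`. -/
def threshold (σ : Substitution) (C : ℕ) : ℕ :=
  max (2 * C + max (σ false).length (σ true).length)
    ((σ false).length + (σ true).length - 1)

/-- The finite set of all words `W` with `1 ≤ |W| ≤ L`. -/
noncomputable def shortWords (L : ℕ) : Finset Word :=
  (List.finite_length_le Letter L).toFinset.filter fun W => 1 ≤ W.length

open scoped Classical in
/-- The special words `W` with `1 ≤ |W| ≤ L`. -/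
noncomputable def shortSpecial (ξ : ℕ → Letter) (L : ℕ) : Finset Word :=
  (shortWords L).filter fun W => IsSpecial ξ W

open scoped Classical in
/-- The initial strong special words: `1 ≤ |W| ≤ L < |T(W)|`. -/
noncomputable def initialStrong (σ : Substitution) (ξ : ℕ → Letter) (L : ℕ) : Finset Word :=
  (shortWords L).filter fun W => IsStrongSpecial ξ W ∧ L < (opT σ W).length

open scoped Classical in
/-- The initial weak special words: `1 ≤ |W| ≤ L < |T(W)|`. -/
noncomputable def initialWeak (σ : Substitution) (ξ : ℕ → Letter) (L : ℕ) : Finset Word :=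
  (shortWords L).filter fun W => IsWeakSpecial ξ W ∧ L < (opT σ W).length

/-- `sgn(W)`: `-1` on initial weak, `1` on initial strong special words, `0` otherwise. -/
noncomputable def sgn (σ : Substitution) (ξ : ℕ → Letter) (L : ℕ) (W : Word) : ℤ :=
  if W ∈ initialWeak σ ξ L then -1 else if W ∈ initialStrong σ ξ L then 1 else 0

/-- The Kronecker symbol. -/
def kron (i j : ℕ) : ℤ := if i = j then 1 else 0

end BinarySubst

namespace BinarySubst

/-! ### Factors of infinite words -/

/-! A special word has zero, one or two special left prolongations, so `s(n+1) - s(n)` is the number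
of strong words of length `n` minus the number of weak ones (`specialCount_succ_add`). The task is
to generate the long strong and weak words from short ones.

The words `W₀σ(x)` equal `τ(x)W₀`, where `τ(a)` and `τ(b)` end with distinct letters
(`exists_conjugate`). Hence if `σ(P)` and `σ(Q)` have a common suffix preceded by distinct letters,
it is `T` of the common suffix of `P` and `Q`, and the preceding letters are permuted by
`markLetter` (`exists_eq_opT`). Beyond the threshold, recognizability forces the end of a special
word to be a cutting position (`end_mem_cuttingPositions`). A long bispecial word is therefore
`T(W)` for a unique `W` with the same two-sided extensions up to that permutation
(`exists_eq_opT_of_isBispecial`), so being strong or weak is preserved in both directions. Since `T`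
is injective and at least doubles lengths, desubstitution ends at exactly one initial word
(`ncard_eq_sum_tsum_kron`).

A recognizability constant exists because a window with two decompositions that share no cutting
position is eventually periodic (`periodic_of_disjoint`), whereas a shared one propagates to the
left (`mem_cuttingPositions_of_common`). Long periodic stretches contradict the bounded gaps between
occurrences of a prefix that breaks the period. -/

@[simp] lemma length_factorAt (ξ : ℕ → Letter) (i n : ℕ) : (factorAt ξ i n).length = n := by
  simp [factorAt]

@[simp] lemma factorAt_zero (ξ : ℕ → Letter) (i : ℕ) : factorAt ξ i 0 = [] := by
  simp [factorAt]

lemma getElem_factorAt (ξ : ℕ → Letter) (i n t : ℕ) (h : t < (factorAt ξ i n).length) :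
    (factorAt ξ i n)[t] = ξ (i + t) := by
  simp [factorAt]

lemma factorAt_one (ξ : ℕ → Letter) (i : ℕ) : factorAt ξ i 1 = [ξ i] := by
  simp [factorAt]

lemma factorAt_add (ξ : ℕ → Letter) (i m n : ℕ) :
    factorAt ξ i (m + n) = factorAt ξ i m ++ factorAt ξ (i + m) n := by
  simp [factorAt, List.ofFn_add, add_assoc]

lemma factorAt_eq_iff {ξ η : ℕ → Letter} {i j n : ℕ} :
    factorAt ξ i n = factorAt η j n ↔ ∀ t < n, ξ (i + t) = η (j + t) := by
  constructor
  · intro h t ht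
    have h' := congrArg (fun l : Word => l[t]?) h
    simpa [factorAt, ht] using h'
  · intro h
    apply List.ext_getElem
    · simp
    · intro t h1 h2
      rw [getElem_factorAt, getElem_factorAt]
      exact h t (by simpa using h1)

lemma isFactor_factorAt (ξ : ℕ → Letter) (i n : ℕ) : IsFactor ξ (factorAt ξ i n) :=
  ⟨i, by simp⟩

lemma factorAt_eq_append_iff {ξ : ℕ → Letter} {i : ℕ} {U V : Word} :
    factorAt ξ i (U ++ V).length = U ++ V ↔
      factorAt ξ i U.length = U ∧ factorAt ξ (i + U.length) V.length = V := by
  rw [List.length_append, factorAt_add]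
  constructor
  · intro h
    exact List.append_inj h (by simp)
  · rintro ⟨h1, h2⟩
    rw [h1, h2]

lemma IsFactor.of_infix {ξ : ℕ → Letter} {V W : Word} (h : IsFactor ξ W) (hV : V <:+: W) :
    IsFactor ξ V := by
  obtain ⟨i, hi⟩ := h
  obtain ⟨X, Y, rfl⟩ := hV
  rw [List.append_assoc, factorAt_eq_append_iff, factorAt_eq_append_iff] at hi
  exact ⟨_, hi.2.1⟩

/-! ### Images under the substitution -/

@[simp] lemma applyWord_nil (σ : Substitution) : applyWord σ [] = [] := rfl

@[simp] lemma applyWord_append (σ : Substitution) (U V : Word) :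
    applyWord σ (U ++ V) = applyWord σ U ++ applyWord σ V := by
  simp [applyWord]

@[simp] lemma applyWord_cons (σ : Substitution) (x : Letter) (V : Word) :
    applyWord σ (x :: V) = σ x ++ applyWord σ V := by
  simp [applyWord]

/-- Both images contain both letters. -/
lemma mem_image_of_isPrimitive {σ : Substitution} (hm : IsWellMarked σ) (hp : IsPrimitive σ)
    (x y : Letter) : y ∈ σ x := by
  by_cases hxy : y = x
  · obtain ⟨u, hu⟩ := hm x
    simp [hu, hxy]
  by_contra hy
  obtain ⟨k, hk, hpos⟩ := hp.exists_pos_pow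
  have hz : incidenceMatrix σ y x = 0 := by
    simp [incidenceMatrix, List.count_eq_zero_of_not_mem hy]
  -- A missing off-diagonal letter makes the matrix triangular, and this zero survives in all
  -- powers.
  have key : ∀ n : ℕ, ((incidenceMatrix σ) ^ n) y x = 0 := by
    intro n
    induction n with
    | zero => simp [hxy]
    | succ n ih =>
      rw [pow_succ, Matrix.mul_apply, Fintype.sum_bool]
      cases x <;> cases y <;> simp_all
  exact absurd (hpos y x) (by simp [key k])

lemma two_le_length {σ : Substitution} (hm : IsWellMarked σ) (hp : IsPrimitive σ) (x : Letter) :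
    2 ≤ (σ x).length := by
  obtain ⟨u, hu⟩ := hm x
  have h := mem_image_of_isPrimitive hm hp x (!x)
  rw [hu] at h ⊢
  cases u with
  | nil => cases x <;> simp at h
  | cons z u => simp

lemma two_mul_length_le {σ : Substitution} (h2 : ∀ x, 2 ≤ (σ x).length) (W : Word) :
    2 * W.length ≤ (applyWord σ W).length := by
  induction W with
  | nil => simp
  | cons x W ih =>
    have := h2 x
    simp only [applyWord_cons, List.length_append, List.length_cons]
    omega

/-- The maximal length of the two images. -/
def maxLen (σ : Substitution) : ℕ := max (σ false).length (σ true).length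

lemma length_le_maxLen (σ : Substitution) (x : Letter) : (σ x).length ≤ maxLen σ := by
  cases x <;> simp [maxLen]

/-- The `k`-th cutting position. -/
def cut (σ : Substitution) (ξ : ℕ → Letter) (k : ℕ) : ℕ := (applyWord σ (factorAt ξ 0 k)).length

@[simp] lemma cut_zero (σ : Substitution) (ξ : ℕ → Letter) : cut σ ξ 0 = 0 := by simp [cut]

lemma cut_add (σ : Substitution) (ξ : ℕ → Letter) (k m : ℕ) :
    cut σ ξ (k + m) = cut σ ξ k + (applyWord σ (factorAt ξ k m)).length := by
  simp [cut, factorAt_add]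

lemma cut_succ (σ : Substitution) (ξ : ℕ → Letter) (k : ℕ) :
    cut σ ξ (k + 1) = cut σ ξ k + (σ (ξ k)).length := by
  simp [cut_add, factorAt_one]

lemma mem_cuttingPositions {σ : Substitution} {ξ : ℕ → Letter} {n : ℕ} :
    n ∈ cuttingPositions σ ξ ↔ ∃ k, n = cut σ ξ k := Iff.rfl

lemma two_mul_le_cut {σ : Substitution} (h2 : ∀ x, 2 ≤ (σ x).length) (ξ : ℕ → Letter) (k : ℕ) :
    2 * k ≤ cut σ ξ k := by
  simpa [cut] using two_mul_length_le h2 (factorAt ξ 0 k)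

lemma exists_eq_cut_add {σ : Substitution} (h2 : ∀ x, 2 ≤ (σ x).length) (ξ : ℕ → Letter) (p : ℕ) :
    ∃ k o, p = cut σ ξ k + o ∧ o < (σ (ξ k)).length := by
  induction p with
  | zero => exact ⟨0, 0, by simp, by have := h2 (ξ 0); omega⟩
  | succ p ih =>
    obtain ⟨k, o, hp, ho⟩ := ih
    by_cases h : o + 1 < (σ (ξ k)).length
    · exact ⟨k, o + 1, by omega, h⟩
    · refine ⟨k + 1, 0, ?_, by have := h2 (ξ (k + 1)); omega⟩
      rw [cut_succ]; omega

namespace IsFixedPoint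

variable {σ : Substitution} {ξ : ℕ → Letter}

lemma applyWord_factorAt (h : IsFixedPoint σ ξ) (k m : ℕ) :
    applyWord σ (factorAt ξ k m) =
      factorAt ξ (cut σ ξ k) (applyWord σ (factorAt ξ k m)).length := by
  have h1 := h (k + m)
  rw [factorAt_add, applyWord_append, List.length_append, factorAt_add, zero_add, zero_add] at h1
  exact (List.append_inj h1 (by simp)).2

lemma image_eq (h : IsFixedPoint σ ξ) (k : ℕ) :
    σ (ξ k) = factorAt ξ (cut σ ξ k) (σ (ξ k)).length := by
  simpa [factorAt_one] using h.applyWord_factorAt k 1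

lemma apply_cut_add (h : IsFixedPoint σ ξ) {k o : ℕ} (ho : o < (σ (ξ k)).length) :
    ξ (cut σ ξ k + o) = (σ (ξ k)).getD o false := by
  have h1 := congrArg (fun l : Word => l.getD o false) (h.image_eq k)
  rw [h1]
  simp [factorAt, ho]

lemma apply_cut (h : IsFixedPoint σ ξ) (hm : IsWellMarked σ) (k : ℕ) : ξ (cut σ ξ k) = ξ k := by
  obtain ⟨u, hu⟩ := hm (ξ k)
  have := h.apply_cut_add (k := k) (o := 0) (by simp [hu])
  rwa [add_zero, hu, List.getD_cons_zero] at this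

/-- Blocks have length at least two, so each position after the first lies in the image of a letter
at an earlier position. -/
lemma ext_of_zero {η : ℕ → Letter} (h : IsFixedPoint σ ξ) (h' : IsFixedPoint σ η)
    (h2 : ∀ x, 2 ≤ (σ x).length) (h0 : ξ 0 = η 0) : ξ = η := by
  funext n
  induction n using Nat.strong_induction_on with
  | _ n ih =>
    rcases Nat.eq_zero_or_pos n with rfl | hn
    · exact h0
    obtain ⟨k, o, hp, ho⟩ := exists_eq_cut_add h2 ξ n
    have hk : k < n := by
      have := two_mul_le_cut h2 ξ k
      omega
    have hc : cut σ ξ k = cut σ η k := by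
      rw [cut, cut, factorAt_eq_iff.2]
      intro t ht
      exact ih _ (by omega)
    have hx : ξ k = η k := ih k hk
    rw [hp, h.apply_cut_add ho, hc, h'.apply_cut_add (hx ▸ ho), hx]

/-- Every prefix occurs with bounded gaps. -/
lemma uniformly_recurrent (h : IsFixedPoint σ ξ) (hm : IsWellMarked σ) (hp : IsPrimitive σ)
    (N : ℕ) : ∃ R, ∀ s, ∃ s', s ≤ s' ∧ s' ≤ s + R ∧ ∀ t < N, ξ (s' + t) = ξ t := by
  have h2 := two_le_length hm hp
  have next : ∀ s, ∃ k, s ≤ cut σ ξ k ∧ cut σ ξ k ≤ s + maxLen σ := by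
    intro s
    obtain ⟨k, o, hs, ho⟩ := exists_eq_cut_add h2 ξ s
    have := length_le_maxLen σ (ξ k)
    exact ⟨k + 1, by rw [cut_succ]; omega, by rw [cut_succ]; omega⟩
  induction N using Nat.strong_induction_on with
  | _ N ih =>
    rcases Nat.lt_or_ge N 2 with hN | hN
    · refine ⟨2 * maxLen σ, fun s => ?_⟩
      obtain ⟨k, hk1, hk2⟩ := next s
      obtain ⟨o, ho, hoe⟩ := List.mem_iff_getElem.1 (mem_image_of_isPrimitive hm hp (ξ k) (ξ 0))
      have := length_le_maxLen σ (ξ k)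
      refine ⟨cut σ ξ k + o, by omega, by omega, fun t ht => ?_⟩
      obtain rfl : t = 0 := by omega
      rw [add_zero, h.apply_cut_add ho, List.getD_eq_getElem _ _ ho, hoe]
    -- The image of an occurrence of the prefix of length `N - 1` is an occurrence of a prefix of
    -- length at least `2(N - 1) ≥ N`.
    · obtain ⟨R, hR⟩ := ih (N - 1) (by omega)
      refine ⟨maxLen σ + R * maxLen σ, fun s => ?_⟩
      obtain ⟨k, hk1, hk2⟩ := next s
      obtain ⟨k', hk1', hk2', hk'⟩ := hR k
      have hle : ∀ W : Word, (applyWord σ W).length ≤ W.length * maxLen σ := by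
        intro W
        induction W with
        | nil => simp
        | cons x W ih =>
          have := length_le_maxLen σ x
          simp only [applyWord_cons, List.length_append, List.length_cons]
          nlinarith
      obtain ⟨d, rfl⟩ := Nat.exists_eq_add_of_le hk1'
      have hd := hle (factorAt ξ k d)
      rw [length_factorAt] at hd
      have hd' : d * maxLen σ ≤ R * maxLen σ := Nat.mul_le_mul_right _ (by omega)
      have hc := cut_add σ ξ k d
      refine ⟨cut σ ξ (k + d), by omega, by omega, fun t ht => ?_⟩
      have e : factorAt ξ (k + d) (N - 1) = factorAt ξ 0 (N - 1) :=
        factorAt_eq_iff.2 fun t ht => by simpa using hk' t ht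
      have e1 := h.applyWord_factorAt (k + d) (N - 1)
      rw [e, h (N - 1), length_factorAt] at e1
      have e2 := two_mul_le_cut h2 ξ (N - 1)
      have e3 := factorAt_eq_iff.1 e1 t (by unfold cut at e2; omega)
      rw [← e3, zero_add]

/-- Every factor occurs arbitrarily far to the right. -/
lemma recurrent (h : IsFixedPoint σ ξ) (hm : IsWellMarked σ) (hp : IsPrimitive σ) {W : Word}
    (hW : IsFactor ξ W) (N : ℕ) : ∃ i ≥ N, factorAt ξ i W.length = W := by
  obtain ⟨i, hi⟩ := hW
  obtain ⟨R, hR⟩ := h.uniformly_recurrent hm hp (i + W.length)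
  obtain ⟨s, hs, -, hs'⟩ := hR N
  refine ⟨s + i, by omega, ?_⟩
  conv_rhs => rw [← hi]
  refine factorAt_eq_iff.2 fun t ht => ?_
  rw [add_assoc]
  exact hs' _ (by omega)

lemma exists_left_extension (h : IsFixedPoint σ ξ) (hm : IsWellMarked σ) (hp : IsPrimitive σ)
    {W : Word} (hW : IsFactor ξ W) : ∃ z, IsFactor ξ (z :: W) := by
  obtain ⟨i, hi, hiW⟩ := h.recurrent hm hp hW 1
  obtain ⟨i, rfl⟩ := Nat.exists_eq_add_of_le' hi
  refine ⟨ξ i, i, ?_⟩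
  rw [List.length_cons, add_comm, factorAt_add, factorAt_one, hiW, List.singleton_append]

end IsFixedPoint

/-! ### The word `W₀` and the conjugate substitution -/

lemma leftPower_of_lt {A : Word} {i : ℕ} (h : i < A.length) :
    leftPower A i = A.reverse.getD i false := by
  rw [leftPower, Nat.mod_eq_of_lt h]

lemma leftPower_add_length (A : Word) (i : ℕ) : leftPower A (A.length + i) = leftPower A i := by
  simp [leftPower]

lemma leftPower_last {x : Letter} {u : Word} : leftPower (x :: u) u.length = x := by
  rw [leftPower_of_lt (by simp)]
  simp

lemma factorAt_leftPower (A : Word) : factorAt (leftPower A) 0 A.length = A.reverse := by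
  apply List.ext_getElem
  · simp
  · intro t h1 h2
    rw [getElem_factorAt, zero_add, leftPower_of_lt (by simpa using h1),
      List.getD_eq_getElem _ _ h2]

/-- A Fine–Wilf type argument: at distance `|σ(a)| + |σ(b)| - 1` from the right, periodicity and the
assumed agreement lead back to the first letters of `σ(b)` and `σ(a)`, which differ. -/
lemma exists_leftPower_ne {σ : Substitution} (hm : IsWellMarked σ) :
    ∃ i, i ≤ (σ false).length + (σ true).length - 1 ∧
      leftPower (σ false) i ≠ leftPower (σ true) i := by
  by_contra! hall
  obtain ⟨u, hu⟩ := hm false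
  obtain ⟨v, hv⟩ := hm true
  rw [hu, hv] at hall
  simp only [List.length_cons] at hall
  have h1 := hall (u.length + 1 + v.length) (by omega)
  have h2 := hall u.length (by omega)
  have h3 := hall v.length (by omega)
  have e1 := leftPower_add_length (false :: u) v.length
  have e2 := leftPower_add_length (true :: v) u.length
  simp only [List.length_cons] at e1 e2
  rw [show v.length + 1 + u.length = u.length + 1 + v.length by omega] at e2
  rw [e1, e2, h3, ← h2, leftPower_last, leftPower_last] at h1
  exact Bool.noConfusion h1

lemma lengthW0_le {σ : Substitution} (hm : IsWellMarked σ) :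
    lengthW0 σ ≤ (σ false).length + (σ true).length - 1 := by
  obtain ⟨i, hi, hne⟩ := exists_leftPower_ne hm
  exact (Nat.sInf_le hne).trans hi

/-- The letter that precedes the occurrence of `W₀` at the right end of `⋯σ(x)σ(x)`. -/
noncomputable def markLetter (σ : Substitution) (x : Letter) : Letter :=
  leftPower (σ x) (lengthW0 σ)

lemma markLetter_injective {σ : Substitution} (hm : IsWellMarked σ) :
    Function.Injective (markLetter σ) := by
  obtain ⟨i, -, hne⟩ := exists_leftPower_ne hm
  have h : leftPower (σ false) (lengthW0 σ) ≠ leftPower (σ true) (lengthW0 σ) :=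
    Nat.sInf_mem (s := {i : ℕ | leftPower (σ false) i ≠ leftPower (σ true) i}) ⟨i, hne⟩
  intro x y hxy
  cases x <;> cases y <;> first | rfl | exact absurd hxy h | exact absurd hxy.symm h

lemma markLetter_surjective {σ : Substitution} (hm : IsWellMarked σ) :
    Function.Surjective (markLetter σ) :=
  Finite.surjective_of_injective (markLetter_injective hm)

lemma wordW0_eq (σ : Substitution) (x : Letter) :
    wordW0 σ = (factorAt (leftPower (σ x)) 0 (lengthW0 σ)).reverse := by
  have h : wordW0 σ = (factorAt (leftPower (σ false)) 0 (lengthW0 σ)).reverse := by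
    simp [wordW0, factorAt]
  rw [h]
  cases x
  · rfl
  · rw [factorAt_eq_iff.2]
    intro t ht
    by_contra hne
    rw [zero_add] at hne
    exact absurd (Nat.sInf_le (s := {i : ℕ | leftPower (σ false) i ≠ leftPower (σ true) i}) hne)
      (not_le.2 ht)

@[simp] lemma length_wordW0 (σ : Substitution) : (wordW0 σ).length = lengthW0 σ := by
  simp [wordW0]

/-- The substitution `τ` with `W₀σ(x) = τ(x)W₀`; its images end with distinct letters. -/
lemma exists_conjugate {σ : Substitution} (hm : IsWellMarked σ) :
    ∃ τ : Substitution, ∀ x, wordW0 σ ++ σ x = τ x ++ wordW0 σ ∧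
      ∃ u, τ x = u ++ [markLetter σ x] := by
  have key : ∀ x, ∃ u : Word, wordW0 σ ++ σ x = (u ++ [markLetter σ x]) ++ wordW0 σ := by
    intro x
    obtain ⟨v, hv⟩ := hm x
    -- Both sides are the suffix of length `|σ(x)| + |W₀|` of `⋯σ(x)σ(x)`, read from the right. Its
    -- last `|W₀|` letters form `W₀` and are preceded by the mark letter.
    have e : factorAt (leftPower (σ x)) 0 ((σ x).length + lengthW0 σ) =
        (wordW0 σ ++ σ x).reverse := by
      rw [factorAt_add, factorAt_leftPower, List.reverse_append, wordW0_eq σ x,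
        List.reverse_reverse]
      congr 1
      refine factorAt_eq_iff.2 fun t _ => ?_
      rw [zero_add, zero_add, leftPower_add_length]
    rw [show (σ x).length + lengthW0 σ = lengthW0 σ + (1 + v.length) by rw [hv]; simp; omega,
      factorAt_add, factorAt_add, factorAt_one, zero_add] at e
    refine ⟨(factorAt (leftPower (σ x)) (lengthW0 σ + 1) v.length).reverse, ?_⟩
    rw [← List.reverse_inj, ← e, wordW0_eq σ x]
    simp [markLetter]
  choose u hu using key
  exact ⟨fun x => u x ++ [markLetter σ x], fun x => ⟨hu x, u x, rfl⟩⟩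

lemma wordW0_append_applyWord {σ τ : Substitution}
    (hτ : ∀ x, wordW0 σ ++ σ x = τ x ++ wordW0 σ) (W : Word) :
    wordW0 σ ++ applyWord σ W = applyWord τ W ++ wordW0 σ := by
  induction W with
  | nil => simp
  | cons x W ih =>
    rw [applyWord_cons, ← List.append_assoc, hτ, List.append_assoc, ih, applyWord_cons,
      List.append_assoc]

lemma length_opT (σ : Substitution) (W : Word) :
    (opT σ W).length = lengthW0 σ + (applyWord σ W).length := by
  simp [opT]

/-- `T(zW)` ends with `π(z)T(W)`, where `π` is a permutation of the letters. -/
lemma markLetter_cons_opT_suffix {σ : Substitution} (hm : IsWellMarked σ) {z : Letter}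
    {W P : Word} (h : z :: W <:+ P) :
    markLetter σ z :: opT σ W <:+ opT σ P := by
  obtain ⟨τ, hτ⟩ := exists_conjugate hm
  obtain ⟨Q, rfl⟩ := h
  obtain ⟨u, hu⟩ := (hτ z).2
  have e := wordW0_append_applyWord (fun x => (hτ x).1)
  refine ⟨applyWord τ Q ++ u, ?_⟩
  rw [opT, opT, e, e, applyWord_append, applyWord_cons, hu]
  simp

lemma applyWord_suffix {σ : Substitution} {U V : Word} (h : U <:+ V) :
    applyWord σ U <:+ applyWord σ V := by
  obtain ⟨X, rfl⟩ := h
  exact ⟨applyWord σ X, by simp⟩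

lemma applyWord_injective {σ : Substitution} (hm : IsWellMarked σ) :
    Function.Injective (applyWord σ) := by
  intro U
  induction U with
  | nil =>
    intro V h
    cases V with
    | nil => rfl
    | cons y V =>
      obtain ⟨v, hv⟩ := hm y
      simp [hv] at h
  | cons x U ih =>
    intro V h
    obtain ⟨u, hu⟩ := hm x
    cases V with
    | nil => simp [hu] at h
    | cons y V =>
      obtain ⟨v, hv⟩ := hm y
      have hxy : x = y := by
        simp [hu, hv] at h
        exact h.1
      subst hxy
      rw [applyWord_cons, applyWord_cons, List.append_cancel_left_eq] at h
      rw [ih h]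

lemma opT_injective {σ : Substitution} (hm : IsWellMarked σ) : Function.Injective (opT σ) := by
  intro U V h
  exact applyWord_injective hm (List.append_cancel_left h)

/-! ### Common suffixes -/

lemma prefix_or_prefix_or_exists_ne (P Q : Word) :
    P <+: Q ∨ Q <+: P ∨ ∃ (W : Word) (z z' : Letter),
      z ≠ z' ∧ W ++ [z] <+: P ∧ W ++ [z'] <+: Q := by
  induction P generalizing Q with
  | nil => exact Or.inl (List.nil_prefix)
  | cons x P ih =>
    cases Q with
    | nil => exact Or.inr (Or.inl List.nil_prefix)
    | cons y Q =>
      by_cases hxy : x = y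
      · subst hxy
        rcases ih Q with h | h | ⟨W, z, z', hz, h1, h2⟩
        · exact Or.inl (by simpa using h)
        · exact Or.inr (Or.inl (by simpa using h))
        · exact Or.inr (Or.inr ⟨x :: W, z, z', hz, by simpa using h1, by simpa using h2⟩)
      · exact Or.inr (Or.inr ⟨[], x, y, hxy, by simp, by simp⟩)

lemma suffix_or_suffix_or_exists_ne (P Q : Word) :
    P <:+ Q ∨ Q <:+ P ∨ ∃ (W : Word) (z z' : Letter), z ≠ z' ∧ z :: W <:+ P ∧ z' :: W <:+ Q := by
  rcases prefix_or_prefix_or_exists_ne P.reverse Q.reverse with h | h | ⟨W, z, z', hz, h1, h2⟩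
  · exact Or.inl (List.reverse_prefix.1 h)
  · exact Or.inr (Or.inl (List.reverse_prefix.1 h))
  · refine Or.inr (Or.inr ⟨W.reverse, z, z', hz, ?_, ?_⟩) <;> rw [← List.reverse_prefix] <;>
      simpa

/-- The first disagreement of `X` and `Y` from the right is unique: an earlier one would lie inside
the common suffix given by the other. -/
lemma eq_of_cons_suffix {X Y U V : Word} {c c' y y' : Letter} (hc : c ≠ c') (hy : y ≠ y')
    (h1 : c :: U <:+ X) (h2 : y :: V <:+ X) (h3 : c' :: U <:+ Y) (h4 : y' :: V <:+ Y) :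
    U = V ∧ c = y ∧ c' = y' := by
  have key : ∀ {U V : Word} {c y : Letter}, c :: U <:+ X → y :: V <:+ X →
      U.length < V.length → c :: U <:+ V := fun h h' hl =>
    List.suffix_of_suffix_length_le h ((List.suffix_cons _ _).trans h') (by simpa using hl)
  have key' : ∀ {U V : Word} {c y : Letter}, c :: U <:+ Y → y :: V <:+ Y →
      U.length < V.length → c :: U <:+ V := fun h h' hl =>
    List.suffix_of_suffix_length_le h ((List.suffix_cons _ _).trans h') (by simpa using hl)
  have uniq : ∀ {Z A B : Word} {a b : Letter}, a :: A <:+ Z → b :: B <:+ Z →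
      A.length = B.length → a = b ∧ A = B := by
    intro Z A B a b h h' hl
    have := (List.suffix_of_suffix_length_le h h' (by simp [hl])).eq_of_length (by simp [hl])
    simpa using this
  rcases lt_trichotomy U.length V.length with hl | hl | hl
  · exact absurd (uniq (key h1 h2 hl) (key' h3 h4 hl) rfl).1 hc
  · exact ⟨(uniq h1 h2 hl).2, (uniq h1 h2 hl).1, (uniq h3 h4 hl).1⟩
  · exact absurd (uniq (key h2 h1 hl) (key' h4 h3 hl) rfl).1 hy

lemma applyWord_suffix_opT (σ : Substitution) (W : Word) : applyWord σ W <:+ opT σ W :=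
  List.suffix_append _ _

/-- If the images of two words end with the same word preceded by distinct letters, then this
common suffix is the `T`-image of the common suffix of the two words. -/
lemma exists_eq_opT {σ : Substitution} (hm : IsWellMarked σ) {P Q V : Word} {y y' : Letter}
    (hy : y ≠ y') (hP : y :: V <:+ applyWord σ P) (hQ : y' :: V <:+ applyWord σ Q) :
    ∃ W z z', z :: W <:+ P ∧ z' :: W <:+ Q ∧ V = opT σ W ∧ y = markLetter σ z ∧
      y' = markLetter σ z' := by
  have ne : ∀ X : Word, y :: V <:+ X → y' :: V <:+ X → False := by
    intro X h h'
    have := (List.suffix_of_suffix_length_le h h' (by simp)).eq_of_length (by simp)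
    simp at this
    exact hy this
  rcases suffix_or_suffix_or_exists_ne P Q with h | h | ⟨W, z, z', hz, h1, h2⟩
  · exact (ne _ (hP.trans (applyWord_suffix h)) hQ).elim
  · exact (ne _ hP (hQ.trans (applyWord_suffix h))).elim
  · obtain ⟨e, e1, e2⟩ := eq_of_cons_suffix ((markLetter_injective hm).ne hz) hy
      (markLetter_cons_opT_suffix hm h1) (hP.trans (applyWord_suffix_opT σ P))
      (markLetter_cons_opT_suffix hm h2) (hQ.trans (applyWord_suffix_opT σ Q))
    exact ⟨W, z, z', h1, h2, e.symm, e1.symm, e2.symm⟩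

/-- If the images of two words share a suffix that is longer than `σ(R)` by at least `|W₀|`,
where `R` is a suffix of the first word, then `R` is a suffix of the second word too. -/
lemma suffix_of_common_suffix {σ : Substitution} (hm : IsWellMarked σ)
    {P Q R S : Word} (hR : R <:+ P) (hSP : S <:+ applyWord σ P) (hSQ : S <:+ applyWord σ Q)
    (hS : lengthW0 σ + (applyWord σ R).length ≤ S.length) : R <:+ Q := by
  have pos : ∀ x, 1 ≤ (σ x).length := fun x => by
    obtain ⟨u, hu⟩ := hm x
    simp [hu]
  rcases suffix_or_suffix_or_exists_ne R Q with h | ⟨U, hU⟩ | ⟨W, z, z', hz, h1, h2⟩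
  · exact h
  · have := hSQ.length_le
    cases U with
    | nil => exact ⟨[], by simpa using hU.symm⟩
    | cons x U =>
      have := pos x
      rw [← hU] at hS
      simp only [List.cons_append, applyWord_cons, applyWord_append, List.length_append] at hS
      omega
  -- `T(W)` and one further letter fit into `S`, so the two distinct mark letters would coincide.
  · exfalso
    have hl : (opT σ W).length + 1 ≤ S.length := by
      have e1 := (applyWord_suffix (σ := σ) h1).length_le
      have := pos z
      rw [applyWord_cons, List.length_append] at e1
      rw [length_opT]
      omega
    have f1 := List.suffix_of_suffix_length_le (markLetter_cons_opT_suffix hm (h1.trans hR))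
      (hSP.trans (applyWord_suffix_opT σ P)) (by simpa using hl)
    have f2 := List.suffix_of_suffix_length_le (markLetter_cons_opT_suffix hm h2)
      (hSQ.trans (applyWord_suffix_opT σ Q)) (by simpa using hl)
    have := (List.suffix_of_suffix_length_le f1 f2 (by simp)).eq_of_length (by simp)
    simp only [List.cons.injEq, and_true] at this
    exact hz (markLetter_injective hm this)

/-! ### Recognizability -/

/-- The block of the decomposition `ξ = σ(ξ₀)σ(ξ₁)⋯` that covers a position, as a letter, and
the offset of the position in this block. -/
def blockState (σ : Substitution) (ξ : ℕ → Letter) : ℕ → Letter × ℕ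
  | 0 => (ξ 0, 0)
  | p + 1 => if (blockState σ ξ p).2 + 1 < (σ (blockState σ ξ p).1).length then
      ((blockState σ ξ p).1, (blockState σ ξ p).2 + 1) else (ξ (p + 1), 0)

namespace IsFixedPoint

variable {σ : Substitution} {ξ : ℕ → Letter}

/-- A new block starts with the very letter whose image it is, because `σ` is well-marked. So
restarting the recursion with the letter just read gives the right block. -/
lemma blockState_cut_add (h : IsFixedPoint σ ξ) (hm : IsWellMarked σ) {k o : ℕ}
    (ho : o < (σ (ξ k)).length) : blockState σ ξ (cut σ ξ k + o) = (ξ k, o) := by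
  induction k generalizing o with
  | zero =>
    induction o with
    | zero => simp [blockState]
    | succ o ih =>
      rw [← add_assoc, blockState, ih (by omega), if_pos ho]
  | succ k ihk =>
    induction o with
    | zero =>
      have pos : 0 < (σ (ξ k)).length := by
        obtain ⟨u, hu⟩ := hm (ξ k)
        simp [hu]
      have e : cut σ ξ (k + 1) = cut σ ξ k + ((σ (ξ k)).length - 1) + 1 := by
        rw [cut_succ]; omega
      rw [add_zero, e, blockState, ihk (by omega), if_neg (by simp only; omega), ← e,
        h.apply_cut hm]
    | succ o ih =>
      rw [← add_assoc, blockState, ih (by omega), if_pos ho]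

lemma blockState_spec (h : IsFixedPoint σ ξ) (hm : IsWellMarked σ) (hp : IsPrimitive σ) (p : ℕ) :
    (blockState σ ξ p).2 < (σ (blockState σ ξ p).1).length ∧
      ξ p = (σ (blockState σ ξ p).1).getD (blockState σ ξ p).2 false := by
  obtain ⟨k, o, rfl, ho⟩ := exists_eq_cut_add (two_le_length hm hp) ξ p
  rw [h.blockState_cut_add hm ho]
  exact ⟨ho, h.apply_cut_add ho⟩

lemma mem_cuttingPositions_iff (h : IsFixedPoint σ ξ) (hm : IsWellMarked σ) (hp : IsPrimitive σ)
    (p : ℕ) : p ∈ cuttingPositions σ ξ ↔ (blockState σ ξ p).2 = 0 := by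
  rw [mem_cuttingPositions]
  constructor
  · rintro ⟨k, rfl⟩
    have := h.blockState_cut_add hm (k := k) (o := 0)
      (by have := two_le_length hm hp (ξ k); omega)
    rw [add_zero] at this
    rw [this]
  · intro h0
    obtain ⟨k, o, rfl, ho⟩ := exists_eq_cut_add (two_le_length hm hp) ξ p
    rw [h.blockState_cut_add hm ho] at h0
    exact ⟨k, by simpa using h0⟩

lemma blockState_of_mem (h : IsFixedPoint σ ξ) (hm : IsWellMarked σ) (hp : IsPrimitive σ)
    {p : ℕ} (hc : p ∈ cuttingPositions σ ξ) : blockState σ ξ p = (ξ p, 0) := by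
  obtain ⟨k, rfl⟩ := hc
  have := h.blockState_cut_add hm (k := k) (o := 0)
    (by have := two_le_length hm hp (ξ k); omega)
  rw [add_zero] at this
  change blockState σ ξ (cut σ ξ k) = (ξ (cut σ ξ k), 0)
  rw [this, h.apply_cut hm]

end IsFixedPoint

/-- The successor of a pair of block states at two positions that are not both followed by
cutting positions and that are followed by the same letter. -/
def jointStep (σ : Substitution) (Z : (Letter × ℕ) × (Letter × ℕ)) :
    (Letter × ℕ) × (Letter × ℕ) :=
  (if Z.1.2 + 1 < (σ Z.1.1).length then (Z.1.1, Z.1.2 + 1)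
    else ((σ Z.2.1).getD (Z.2.2 + 1) false, 0),
   if Z.2.2 + 1 < (σ Z.2.1).length then (Z.2.1, Z.2.2 + 1)
    else ((σ Z.1.1).getD (Z.1.2 + 1) false, 0))

namespace IsFixedPoint

variable {σ : Substitution} {ξ : ℕ → Letter}

/-- If one block ends, the letter of the next block is the letter read there, and the other block,
still running, supplies it. The pair of states thus evolves without reference to `ξ`; the default in
`getD` is never reached. -/
lemma joint_succ (h : IsFixedPoint σ ξ) (hm : IsWellMarked σ) (hp : IsPrimitive σ) {i j : ℕ}
    (hij : ξ (i + 1) = ξ (j + 1))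
    (hc : ¬ (i + 1 ∈ cuttingPositions σ ξ ∧ j + 1 ∈ cuttingPositions σ ξ)) :
    (blockState σ ξ (i + 1), blockState σ ξ (j + 1)) =
      jointStep σ (blockState σ ξ i, blockState σ ξ j) := by
  rw [h.mem_cuttingPositions_iff hm hp, h.mem_cuttingPositions_iff hm hp] at hc
  have hi := (h.blockState_spec hm hp (i + 1)).2
  have hj := (h.blockState_spec hm hp (j + 1)).2
  rw [blockState] at hc hi
  rw [blockState.eq_2 σ ξ j] at hc hj
  rw [blockState, blockState, jointStep]
  generalize blockState σ ξ i = X at *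
  generalize blockState σ ξ j = Y at *
  by_cases a : X.2 + 1 < (σ X.1).length <;> by_cases b : Y.2 + 1 < (σ Y.1).length
  · simp only [if_pos a, if_pos b]
  · simp only [if_pos a] at hi
    simp only [if_pos a, if_neg b, ← hij, ← hi]
  · simp only [if_pos b] at hj
    simp only [if_neg a, if_pos b, hij, ← hj]
  · simp [if_neg a, if_neg b] at hc

/-- A window with two decompositions without common cutting positions is periodic up to a
preperiod of bounded length. -/
lemma periodic_of_disjoint (h : IsFixedPoint σ ξ) (hm : IsWellMarked σ) (hp : IsPrimitive σ)
    {i j l : ℕ} (hij : ∀ t ≤ l, ξ (i + t) = ξ (j + t))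
    (hc : ∀ t ≤ l, ¬ (i + t ∈ cuttingPositions σ ξ ∧ j + t ∈ cuttingPositions σ ξ))
    {N : ℕ} (hN : (2 * maxLen σ) * (2 * maxLen σ) ≤ N) {t : ℕ} (ht : N ≤ t)
    (htl : t + N.factorial ≤ l) : ξ (i + t + N.factorial) = ξ (i + t) := by
  let Z : ℕ → (Letter × ℕ) × (Letter × ℕ) := fun t =>
    (blockState σ ξ (i + t), blockState σ ξ (j + t))
  have hZ : ∀ t, t + 1 ≤ l → Z (t + 1) = jointStep σ (Z t) := fun t ht =>
    h.joint_succ hm hp (hij (t + 1) ht) (hc (t + 1) ht)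
  let S : Finset (Letter × ℕ) := Finset.univ ×ˢ Finset.range (maxLen σ)
  have hS : ∀ p, blockState σ ξ p ∈ S := fun p => by
    simpa [S] using (h.blockState_spec hm hp p).1.trans_le (length_le_maxLen σ _)
  -- There are at most `N` pairs of states, so two of the first `N + 1` times carry the same pair;
  -- the gap `d + 1 ≤ N` then divides `N!`.
  obtain ⟨t₁, h1, t₂, h2, hne, he⟩ := Finset.exists_ne_map_eq_of_card_lt_of_maps_to
    (s := Finset.range (N + 1)) (t := S ×ˢ S) (f := Z) (by simp [S]; omega)
    (fun t _ => by simp [Z, hS])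
  wlog hlt : t₁ < t₂ generalizing t₁ t₂
  · exact this t₂ h2 t₁ h1 hne.symm he.symm (by omega)
  rw [Finset.mem_range] at h1 h2
  obtain ⟨d, rfl⟩ := Nat.exists_eq_add_of_lt hlt
  have hper : ∀ s, t₁ + s + (d + 1) ≤ l → Z (t₁ + s + (d + 1)) = Z (t₁ + s) := by
    intro s
    induction s with
    | zero => intro _; exact he.symm
    | succ s ih =>
      intro hs
      rw [show t₁ + (s + 1) + (d + 1) = t₁ + s + (d + 1) + 1 by omega, hZ _ (by omega),
        ih (by omega), ← hZ _ (by omega), add_assoc]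
  obtain ⟨c, hcd⟩ : d + 1 ∣ N.factorial := Nat.dvd_factorial (by omega) (by omega)
  obtain ⟨s, rfl⟩ := Nat.exists_eq_add_of_le (show t₁ ≤ t by omega)
  have hmul : ∀ m, t₁ + s + (d + 1) * m ≤ l → Z (t₁ + s + (d + 1) * m) = Z (t₁ + s) := by
    intro m
    induction m with
    | zero => intro _; rfl
    | succ m ih =>
      intro hl
      rw [mul_add, mul_one] at hl ⊢
      have := hper (s + (d + 1) * m) (by omega)
      rw [show t₁ + s + ((d + 1) * m + (d + 1)) = t₁ + (s + (d + 1) * m) + (d + 1) by omega, this,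
        ← add_assoc]
      exact ih (by omega)
  have hfin := congrArg Prod.fst (hmul c (by omega))
  simp only [Z] at hfin
  rw [add_assoc i, hcd, (h.blockState_spec hm hp _).2, hfin, ← (h.blockState_spec hm hp _).2]

/-- A common cutting position propagates to the left. -/
lemma mem_cuttingPositions_of_common (h : IsFixedPoint σ ξ) (hm : IsWellMarked σ)
    (hp : IsPrimitive σ) {i j C t : ℕ} (hC : lengthW0 σ ≤ C)
    (hw : ∀ s < C + t, ξ (i + s) = ξ (j + s)) (hi : i + C ∈ cuttingPositions σ ξ)
    (hit : i + C + t ∈ cuttingPositions σ ξ) (hjt : j + C + t ∈ cuttingPositions σ ξ) :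
    j + C ∈ cuttingPositions σ ξ := by
  rw [mem_cuttingPositions] at *
  obtain ⟨k, hk⟩ := hi
  obtain ⟨k₂, hk₂⟩ := hit
  obtain ⟨m, hmm⟩ := hjt
  have hkk : k ≤ k₂ := by
    by_contra! hlt
    obtain ⟨d, rfl⟩ := Nat.exists_eq_add_of_lt hlt
    have e := cut_add σ ξ k₂ (d + 1)
    have := two_mul_length_le (two_le_length hm hp) (factorAt ξ k₂ (d + 1))
    rw [length_factorAt] at this
    rw [← add_assoc] at e
    omega
  obtain ⟨d, rfl⟩ := Nat.exists_eq_add_of_le hkk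
  have hR : factorAt ξ k d <:+ factorAt ξ 0 (k + d) := by
    rw [factorAt_add, zero_add]
    exact List.suffix_append _ _
  have hlen : (applyWord σ (factorAt ξ k d)).length = t := by
    have := cut_add σ ξ k d
    omega
  have suff : ∀ p q, p + C + t = cut σ ξ q →
      factorAt ξ p (C + t) <:+ applyWord σ (factorAt ξ 0 q) := by
    intro p q hq
    rw [h q]
    change _ <:+ factorAt ξ 0 (cut σ ξ q)
    rw [← hq, add_assoc, factorAt_add ξ 0, zero_add]
    exact List.suffix_append _ _
  have hS : factorAt ξ i (C + t) = factorAt ξ j (C + t) := factorAt_eq_iff.2 hw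
  -- The blocks between the two cutting positions near `i` cover `t` letters, and the window extends
  -- `C ≥ |W₀|` letters further left. So the same blocks end at the cutting position near `j`.
  have hRm := suffix_of_common_suffix hm hR (suff i _ hk₂) (hS ▸ suff j _ hmm)
    (by rw [hlen, length_factorAt]; omega)
  have hdm : d ≤ m := by simpa using hRm.length_le
  obtain ⟨e, rfl⟩ := Nat.exists_eq_add_of_le' hdm
  have hsuff : factorAt ξ e d <:+ factorAt ξ 0 (e + d) := by
    rw [factorAt_add, zero_add]
    exact List.suffix_append _ _
  have heq : factorAt ξ k d = factorAt ξ e d :=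
    (List.suffix_of_suffix_length_le hRm hsuff (by simp)).eq_of_length (by simp)
  refine ⟨e, ?_⟩
  have := cut_add σ ξ e d
  rw [← heq, hlen] at this
  omega

lemma exists_isRecognizabilityConstant (h : IsFixedPoint σ ξ) (hm : IsWellMarked σ)
    (hp : IsPrimitive σ) (hξ : ¬ IsUltimatelyPeriodic ξ) :
    ∃ C, IsRecognizabilityConstant σ ξ C := by
  set N := (2 * maxLen σ) * (2 * maxLen σ) with hN
  obtain ⟨p, hpne⟩ : ∃ p, ξ (p + N.factorial) ≠ ξ p := by
    by_contra! hall
    exact hξ ⟨0, N.factorial, N.factorial_pos, fun i _ => hall i⟩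
  obtain ⟨R, hR⟩ := h.uniformly_recurrent hm hp (p + N.factorial + 1)
  -- To the right of the centre the window holds the preperiod `N`, a recurrence gap `R` and a
  -- pattern of length `p + N! + 1` that violates the period `N!`; `|W₀|` serves the propagation to
  -- the left.
  refine ⟨N + R + p + N.factorial + 1 + lengthW0 σ, fun i j hw hi => ?_⟩
  set C := N + R + p + N.factorial + 1 + lengthW0 σ with hC
  rw [factorAt_eq_iff] at hw
  by_contra hj
  have hc : ∀ t ≤ C, ¬ (i + C + t ∈ cuttingPositions σ ξ ∧ j + C + t ∈ cuttingPositions σ ξ) :=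
    fun t ht hh => hj (h.mem_cuttingPositions_of_common hm hp (by omega)
      (fun s hs => hw s (by omega)) hi hh.1 hh.2)
  obtain ⟨s, hs1, hs2, hs⟩ := hR (i + C + N)
  obtain ⟨u, rfl⟩ := Nat.exists_eq_add_of_le hs1
  have := h.periodic_of_disjoint hm hp (l := C) (i := i + C) (j := j + C)
    (fun t ht => by simpa [add_assoc] using hw (C + t) (by omega)) hc hN.ge
    (t := N + u + p) (by omega) (by omega)
  rw [show i + C + (N + u + p) + N.factorial = i + C + N + u + (p + N.factorial) by omega,
    show i + C + (N + u + p) = i + C + N + u + p by omega, hs _ (by omega), hs _ (by omega)] at this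
  exact hpne this

end IsFixedPoint

lemma IsRecognizabilityConstant.mono {σ : Substitution} {ξ : ℕ → Letter} {C D : ℕ}
    (h : IsRecognizabilityConstant σ ξ C) (hCD : C ≤ D) : IsRecognizabilityConstant σ ξ D := by
  obtain ⟨d, rfl⟩ := Nat.exists_eq_add_of_le' hCD
  intro i j hw hi
  rw [← add_assoc] at hi ⊢
  refine h (i + d) (j + d) (factorAt_eq_iff.2 fun t ht => ?_) hi
  have := factorAt_eq_iff.1 hw (d + t) (by omega)
  simpa [add_assoc] using this

/-- The first letter determines a fixed point, so there are at most two, and the larger of their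
constants serves both. -/
lemma exists_uniform_isRecognizabilityConstant {σ : Substitution} (hm : IsWellMarked σ)
    (hp : IsPrimitive σ) : ∃ C : ℕ, ∀ ξ : ℕ → Letter, IsFixedPoint σ ξ →
      ¬ IsUltimatelyPeriodic ξ → IsRecognizabilityConstant σ ξ C := by
  have key : ∀ x : Letter, ∃ C : ℕ, ∀ ξ : ℕ → Letter, IsFixedPoint σ ξ →
      ¬ IsUltimatelyPeriodic ξ → ξ 0 = x → IsRecognizabilityConstant σ ξ C := by
    intro x
    by_cases hx : ∃ η, IsFixedPoint σ η ∧ ¬ IsUltimatelyPeriodic η ∧ η 0 = x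
    · obtain ⟨η, h1, h2, h3⟩ := hx
      obtain ⟨C, hC⟩ := h1.exists_isRecognizabilityConstant hm hp h2
      refine ⟨C, fun ξ h _ h0 => ?_⟩
      rw [h.ext_of_zero h1 (two_le_length hm hp) (h0.trans h3.symm)]
      exact hC
    · exact ⟨0, fun ξ h h' h0 => (hx ⟨ξ, h, h', h0⟩).elim⟩
  choose C hC using key
  refine ⟨max (C false) (C true), fun ξ h h' => (hC (ξ 0) ξ h h' rfl).mono ?_⟩
  cases ξ 0 <;> simp

/-! ### Desubstitution of bispecial words -/

/-- Special words all of whose left prolongations occur. -/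
def IsBispecial (ξ : ℕ → Letter) (W : Word) : Prop :=
  IsSpecial ξ W ∧ ∀ y : Letter, ∃ x : Letter, IsFactor ξ (y :: W ++ [x])

lemma isFactor_cons_append_iff {ξ : ℕ → Letter} {y x : Letter} {V : Word} :
    IsFactor ξ (y :: V ++ [x]) ↔ ∃ i, factorAt ξ i (V.length + 1) = y :: V ∧
      ξ (i + (V.length + 1)) = x := by
  refine exists_congr fun i => ?_
  rw [factorAt_eq_append_iff, List.length_singleton, factorAt_one]
  simp

lemma isFactor_append_iff {ξ : ℕ → Letter} {x : Letter} {V : Word} :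
    IsFactor ξ (V ++ [x]) ↔ ∃ i, factorAt ξ i V.length = V ∧ ξ (i + V.length) = x := by
  refine exists_congr fun i => ?_
  rw [factorAt_eq_append_iff, List.length_singleton, factorAt_one]
  simp

namespace IsFixedPoint

variable {σ : Substitution} {ξ : ℕ → Letter}

/-- An occurrence starting at a position at least `|W₀|` has enough image letters to its left for
all of `W₀` and the mark letter to appear; `σ(x)` begins with `x`. -/
lemma isFactor_markLetter_cons (h : IsFixedPoint σ ξ) (hm : IsWellMarked σ) (hp : IsPrimitive σ)
    {z x : Letter} {W : Word} (hW : IsFactor ξ (z :: W ++ [x])) :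
    IsFactor ξ (markLetter σ z :: opT σ W ++ [x]) := by
  obtain ⟨i, hi, hiW⟩ := h.recurrent hm hp hW (lengthW0 σ)
  have h2 := two_le_length hm hp
  have hu := two_mul_length_le h2 (factorAt ξ 0 i)
  rw [length_factorAt] at hu
  have hfac : IsFactor ξ (applyWord σ (factorAt ξ 0 i ++ (z :: W)) ++ σ x) := by
    have e := h (i + (z :: W ++ [x]).length)
    rw [factorAt_add, zero_add, hiW, ← List.append_assoc, applyWord_append _ _ [x],
      applyWord_cons _ x, applyWord_nil, List.append_nil] at e
    rw [e]
    exact isFactor_factorAt _ _ _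
  have hsuff : markLetter σ z :: opT σ W <:+ applyWord σ (factorAt ξ 0 i ++ (z :: W)) := by
    refine List.suffix_of_suffix_length_le
      (markLetter_cons_opT_suffix hm (List.suffix_append (factorAt ξ 0 i) (z :: W)))
      (applyWord_suffix_opT _ _) ?_
    have := h2 z
    simp only [List.length_cons, length_opT, applyWord_append, applyWord_cons, List.length_append]
    omega
  refine hfac.of_infix ?_
  obtain ⟨X, hX⟩ := hsuff
  obtain ⟨u, hu⟩ := hm x
  exact ⟨X, u, by rw [← hX, hu]; simp⟩

/-- The end of each occurrence of a long special word is a cutting position. -/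
lemma end_mem_cuttingPositions (h : IsFixedPoint σ ξ) (hm : IsWellMarked σ) (hp : IsPrimitive σ)
    {C : ℕ} (hC : IsRecognizabilityConstant σ ξ C) {p q l : ℕ} (hl : threshold σ C < l)
    (hpq : ∀ s < l, ξ (p + s) = ξ (q + s)) (hne : ξ (p + l) ≠ ξ (q + l)) :
    p + l ∈ cuttingPositions σ ξ := by
  have hl' : 2 * C + maxLen σ < l := (le_max_left _ _).trans_lt hl
  -- The next cutting position after `p + C` is at most `maxLen σ` away, so its window of radius `C`
  -- stays inside the common word and recognizability carries it over to `q`.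
  obtain ⟨k, o, hk, ho⟩ := exists_eq_cut_add (two_le_length hm hp) ξ (p + C)
  obtain ⟨t, htl, hpt⟩ : ∃ t ≤ maxLen σ, p + t + C = cut σ ξ (k + 1) := by
    have := length_le_maxLen σ (ξ k)
    refine ⟨(σ (ξ k)).length - o, by omega, ?_⟩
    rw [cut_succ]; omega
  have hp1 : p + t + C ∈ cuttingPositions σ ξ := ⟨k + 1, hpt⟩
  have hq1 : q + t + C ∈ cuttingPositions σ ξ := by
    refine hC (p + t) (q + t) (factorAt_eq_iff.2 fun s hs => ?_) hp1
    simpa [add_assoc] using hpq (t + s) (by omega)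
  have hst : ∀ s, t + C + s < l →
      blockState σ ξ (p + t + C + s) = blockState σ ξ (q + t + C + s) := by
    intro s
    induction s with
    | zero =>
      intro hs
      have := hpq (t + C) (by omega)
      rw [add_zero, add_zero, h.blockState_of_mem hm hp hp1, h.blockState_of_mem hm hp hq1,
        add_assoc, this, add_assoc]
    | succ s ih =>
      intro hs
      have := hpq (t + C + (s + 1)) hs
      rw [← add_assoc, ← add_assoc, blockState, blockState, ih (by omega)]
      simp only [add_assoc] at this ⊢
      rw [this]
  obtain ⟨s, rfl⟩ := Nat.exists_eq_add_of_lt (show t + C < l by omega)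
  have hs := hst s (by omega)
  rw [show p + (t + C + s + 1) = p + t + C + s + 1 by omega,
    show q + (t + C + s + 1) = q + t + C + s + 1 by omega] at *
  rw [h.mem_cuttingPositions_iff hm hp]
  -- Were the end inside a block, both occurrences would continue in the same block and read the
  -- same letter.
  by_contra h0
  refine hne ?_
  have e : blockState σ ξ (p + t + C + s + 1) = blockState σ ξ (q + t + C + s + 1) := by
    rw [blockState] at h0
    split_ifs at h0 with hif
    · rw [blockState, blockState, ← hs, if_pos hif, if_pos hif]
    · exact absurd rfl h0
  rw [(h.blockState_spec hm hp _).2, e, ← (h.blockState_spec hm hp _).2]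

/-- Comparing the given occurrence with one of `V` followed by the other letter shows that its end
is a cutting position. The block that starts there begins with `x`, so it is `σ(x)`. -/
lemma exists_prefix_of_isSpecial (h : IsFixedPoint σ ξ) (hm : IsWellMarked σ) (hp : IsPrimitive σ)
    {C : ℕ} (hC : IsRecognizabilityConstant σ ξ C) {V : Word} (hl : threshold σ C < V.length)
    (hV : IsSpecial ξ V) {y x : Letter} (hyx : IsFactor ξ (y :: V ++ [x])) :
    ∃ k, y :: V <:+ applyWord σ (factorAt ξ 0 k) ∧ ξ k = x := by
  obtain ⟨i, hi, hix⟩ := isFactor_cons_append_iff.1 hyx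
  obtain ⟨q, hq, hqx⟩ := isFactor_append_iff.1 (hV (!x))
  have hi' : factorAt ξ (i + 1) V.length = V := by
    rw [add_comm, factorAt_add, factorAt_one, List.singleton_append] at hi
    exact (List.cons.inj hi).2
  obtain ⟨k, hk⟩ := h.end_mem_cuttingPositions hm hp hC (p := i + 1) (q := q) hl
    (factorAt_eq_iff.1 (hi'.trans hq.symm))
    (by rw [add_assoc, add_comm 1, hix, hqx]; cases x <;> simp)
  refine ⟨k, ?_, ?_⟩
  · rw [h k, ← hk, add_assoc, add_comm 1, factorAt_add, zero_add, hi]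
    exact List.suffix_append _ _
  · rw [← h.apply_cut hm k, cut, ← hk, add_assoc, add_comm 1, hix]

/-- A long bispecial word is the `T`-image of a word with the same two-sided extensions. -/
lemma exists_eq_opT_of_isBispecial (h : IsFixedPoint σ ξ) (hm : IsWellMarked σ)
    (hp : IsPrimitive σ) {C : ℕ} (hC : IsRecognizabilityConstant σ ξ C) {V : Word}
    (hl : threshold σ C < V.length) (hV : IsBispecial ξ V) :
    ∃ W, opT σ W = V ∧ ∀ z x, IsFactor ξ (z :: W ++ [x]) ↔
      IsFactor ξ (markLetter σ z :: V ++ [x]) := by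
  have pre : ∀ y, ∃ k, y :: V <:+ applyWord σ (factorAt ξ 0 k) := fun y => by
    obtain ⟨x, hx⟩ := hV.2 y
    obtain ⟨k, hk, -⟩ := h.exists_prefix_of_isSpecial hm hp hC hl hV.1 hx
    exact ⟨k, hk⟩
  choose k hk using pre
  obtain ⟨W, -, -, -, -, hW, -, -⟩ := exists_eq_opT hm Bool.false_ne_true (hk false) (hk true)
  refine ⟨W, hW.symm, fun z x => ⟨fun hzx => ?_, fun hzx => ?_⟩⟩
  · rw [hW]
    exact h.isFactor_markLetter_cons hm hp hzx
  · obtain ⟨m, hms, hmx⟩ := h.exists_prefix_of_isSpecial hm hp hC hl hV.1 hzx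
    -- Comparing with a prefix image ending in the other left prolongation of `V` desubstitutes this
    -- occurrence; injectivity of `T` and of `markLetter` identifies the result with `W` and `z`.
    obtain ⟨W', z', -, hz', -, hW', e, -⟩ := exists_eq_opT hm
      (show markLetter σ z ≠ !(markLetter σ z) by simp) hms (hk _)
    obtain rfl := opT_injective hm (hW.symm.trans hW')
    obtain rfl := markLetter_injective hm e
    obtain ⟨X, hX⟩ := hz'
    refine (isFactor_factorAt ξ 0 (m + 1)).of_infix ⟨X, [], ?_⟩
    rw [factorAt_add, zero_add, factorAt_one, hmx, ← hX]
    simp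

lemma isSpecial_iff (h : IsFixedPoint σ ξ) (hm : IsWellMarked σ) (hp : IsPrimitive σ)
    {W : Word} : IsSpecial ξ W ↔ ∀ x, ∃ z, IsFactor ξ (z :: W ++ [x]) :=
  ⟨fun hW x => h.exists_left_extension hm hp (hW x),
    fun hW x => (hW x).elim fun z hz => hz.of_infix ⟨[z], [], by simp⟩⟩

/-- Specialness can be read off from two-sided extensions, and permuting the left letters does not
affect it. -/
lemma isSpecial_congr (h : IsFixedPoint σ ξ) (hm : IsWellMarked σ) (hp : IsPrimitive σ)
    {V W : Word} (hVW : ∀ z x, IsFactor ξ (z :: W ++ [x]) ↔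
      IsFactor ξ (markLetter σ z :: V ++ [x])) : IsSpecial ξ W ↔ IsSpecial ξ V := by
  rw [h.isSpecial_iff hm hp, h.isSpecial_iff hm hp]
  refine forall_congr' fun x => ?_
  rw [(markLetter_surjective hm).exists (p := fun y => IsFactor ξ (y :: V ++ [x]))]
  exact exists_congr fun z => hVW z x

lemma isStrongSpecial_congr (h : IsFixedPoint σ ξ) (hm : IsWellMarked σ) (hp : IsPrimitive σ)
    {V W : Word} (hVW : ∀ z x, IsFactor ξ (z :: W ++ [x]) ↔
      IsFactor ξ (markLetter σ z :: V ++ [x])) : IsStrongSpecial ξ W ↔ IsStrongSpecial ξ V := by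
  rw [IsStrongSpecial, IsStrongSpecial, h.isSpecial_congr hm hp hVW,
    (markLetter_surjective hm).forall (p := fun y => IsSpecial ξ (y :: V))]
  exact and_congr_right' (forall_congr' fun z => forall_congr' fun x => hVW z x)

lemma isWeakSpecial_congr (h : IsFixedPoint σ ξ) (hm : IsWellMarked σ) (hp : IsPrimitive σ)
    {V W : Word} (hVW : ∀ z x, IsFactor ξ (z :: W ++ [x]) ↔
      IsFactor ξ (markLetter σ z :: V ++ [x])) : IsWeakSpecial ξ W ↔ IsWeakSpecial ξ V := by
  rw [IsWeakSpecial, IsWeakSpecial, h.isSpecial_congr hm hp hVW,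
    (markLetter_surjective hm).forall (p := fun y => ¬ IsSpecial ξ (y :: V))]
  exact and_congr_right' (forall_congr' fun z => not_congr (forall_congr' fun x => hVW z x))

/-- Some `x` cannot follow the prolongation by the letter other than `y`. Since `Wx` extends to the
left, it does so by `y`. -/
lemma isBispecial_of_isWeakSpecial (h : IsFixedPoint σ ξ) (hm : IsWellMarked σ)
    (hp : IsPrimitive σ) {W : Word} (hW : IsWeakSpecial ξ W) : IsBispecial ξ W := by
  refine ⟨hW.1, fun y => ?_⟩
  obtain ⟨x, hx⟩ := not_forall.1 (hW.2 (!y))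
  obtain ⟨z, hz⟩ := (h.isSpecial_iff hm hp).1 hW.1 x
  refine ⟨x, ?_⟩
  have : z = y := by
    by_contra hzy
    obtain rfl : z = !y := by cases z <;> cases y <;> simp_all
    exact hx hz
  rwa [← this]

lemma isBispecial_opT (h : IsFixedPoint σ ξ) (hm : IsWellMarked σ) (hp : IsPrimitive σ)
    {W : Word} (hW : IsBispecial ξ W) : IsBispecial ξ (opT σ W) := by
  constructor
  · rw [h.isSpecial_iff hm hp]
    intro x
    obtain ⟨z, hz⟩ := (h.isSpecial_iff hm hp).1 hW.1 x
    exact ⟨_, h.isFactor_markLetter_cons hm hp hz⟩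
  · rw [(markLetter_surjective hm).forall]
    intro z
    obtain ⟨x, hx⟩ := hW.2 z
    exact ⟨x, h.isFactor_markLetter_cons hm hp hx⟩

/-- `T(W)` is again bispecial and long, hence desubstitutes, and by injectivity of `T` it can only
do so to `W`. -/
lemma isFactor_iff_of_isBispecial (h : IsFixedPoint σ ξ) (hm : IsWellMarked σ)
    (hp : IsPrimitive σ) {C : ℕ} (hC : IsRecognizabilityConstant σ ξ C) {W : Word}
    (hl : threshold σ C < (opT σ W).length) (hW : IsBispecial ξ W) (z x : Letter) :
    IsFactor ξ (z :: W ++ [x]) ↔ IsFactor ξ (markLetter σ z :: opT σ W ++ [x]) := by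
  obtain ⟨W', hW', hE⟩ := h.exists_eq_opT_of_isBispecial hm hp hC hl (h.isBispecial_opT hm hp hW)
  obtain rfl := opT_injective hm hW'
  exact hE z x

end IsFixedPoint

lemma IsStrongSpecial.isBispecial {ξ : ℕ → Letter} {W : Word} (hW : IsStrongSpecial ξ W) :
    IsBispecial ξ W :=
  ⟨hW.1, fun y => ⟨y, hW.2 y y⟩⟩

/-! ### Counting -/

lemma two_mul_length_le_opT {σ : Substitution} (h2 : ∀ x, 2 ≤ (σ x).length) (W : Word) :
    2 * W.length ≤ (opT σ W).length := by
  have := two_mul_length_le h2 W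
  rw [length_opT]
  omega

lemma lt_length_iterate_opT {σ : Substitution} (h2 : ∀ x, 2 ≤ (σ x).length) {W : Word}
    (hW : 1 ≤ W.length) (k : ℕ) : k < ((opT σ)^[k] W).length := by
  induction k with
  | zero => exact hW
  | succ k ih =>
    rw [Function.iterate_succ_apply']
    have := two_mul_length_le_opT h2 ((opT σ)^[k] W)
    omega

lemma length_opT_le_iterate {σ : Substitution} (h2 : ∀ x, 2 ≤ (σ x).length) (W : Word) (k : ℕ) :
    (opT σ W).length ≤ ((opT σ)^[k + 1] W).length := by
  induction k with
  | zero => rfl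
  | succ k ih =>
    rw [Function.iterate_succ_apply']
    have := two_mul_length_le_opT h2 ((opT σ)^[k + 1] W)
    omega

lemma finite_setOf_length_iterate_eq {σ : Substitution} (h2 : ∀ x, 2 ≤ (σ x).length) {W : Word}
    (hW : 1 ≤ W.length) (n : ℕ) : {k : ℕ+ | ((opT σ)^[(k : ℕ)] W).length = n}.Finite := by
  refine Set.Finite.of_finite_image ((Set.finite_Iio n).subset ?_)
    (PNat.coe_injective.injOn (s := {k : ℕ+ | ((opT σ)^[(k : ℕ)] W).length = n}))
  rintro _ ⟨k, hk, rfl⟩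
  have := lt_length_iterate_opT h2 hW k
  rw [Set.mem_ofPred_eq] at hk
  rw [Set.mem_Iio]
  omega

lemma tsum_kron {f : ℕ+ → ℕ} {n : ℕ} (hf : {k | f k = n}.Finite) :
    ∑' k, kron (f k) n = (hf.toFinset.card : ℤ) := by
  rw [tsum_eq_sum (s := hf.toFinset)]
  · rw [Finset.card_eq_sum_ones, Nat.cast_sum]
    refine Finset.sum_congr rfl fun k hk => ?_
    have : f k = n := by simpa using hk
    simp [kron, this]
  · intro k hk
    have : f k ≠ n := by simpa using hk
    simp [kron, this]

/-- If a property of words is transported by `T` back and forth above the length `L`, then the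
words of length `n > L` with this property are the iterated `T`-images of the initial ones. -/
lemma ncard_eq_sum_tsum_kron {σ : Substitution} (hm : IsWellMarked σ) (hp : IsPrimitive σ)
    {L : ℕ} (hL : lengthW0 σ ≤ L) {Q : Word → Prop}
    (hQ : ∀ W, Q W → L < (opT σ W).length → Q (opT σ W))
    (hQ' : ∀ V, Q V → L < V.length → ∃ W, opT σ W = V ∧ Q W) {S : Finset Word}
    (hS : ∀ W, W ∈ S ↔ (1 ≤ W.length ∧ W.length ≤ L) ∧ Q W ∧ L < (opT σ W).length)
    {n : ℕ} (hn : L < n) :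
    ({V : Word | V.length = n ∧ Q V}.ncard : ℤ) =
      ∑ W ∈ S, ∑' k : ℕ+, kron ((opT σ)^[(k : ℕ)] W).length n := by
  classical
  have h2 := two_le_length hm hp
  have hfin : ∀ W ∈ S, {k : ℕ+ | ((opT σ)^[(k : ℕ)] W).length = n}.Finite :=
    fun W hW => finite_setOf_length_iterate_eq h2 ((hS W).1 hW).1.1 n
  have hQk : ∀ W ∈ S, ∀ k, Q ((opT σ)^[k + 1] W) := by
    intro W hW k
    rw [hS] at hW
    induction k with
    | zero => exact hQ W hW.2.1 hW.2.2
    | succ k ih =>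
      rw [Function.iterate_succ_apply']
      refine hQ _ ih ?_
      rw [← Function.iterate_succ_apply' (opT σ)]
      exact hW.2.2.trans_le (length_opT_le_iterate h2 W _)
  have hdesc : ∀ m, ∀ V : Word, V.length = m → Q V → L < V.length →
      ∃ W ∈ S, ∃ k, (opT σ)^[k + 1] W = V := by
    intro m
    induction m using Nat.strong_induction_on with
    | _ m ih =>
      rintro V rfl hV hl
      obtain ⟨W, rfl, hW⟩ := hQ' V hV hl
      -- The empty word is excluded because its `T`-image `W₀` has length at most `L`.
      have hpos : 1 ≤ W.length := by
        cases W with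
        | nil => simp [length_opT] at hl; omega
        | cons x W => simp
      have := two_mul_length_le_opT h2 W
      rcases Nat.lt_or_ge L W.length with hWl | hWl
      · obtain ⟨X, hX, k, hk⟩ := ih W.length (by omega) W rfl hW hWl
        exact ⟨X, hX, k + 1, by rw [Function.iterate_succ_apply', hk]⟩
      · exact ⟨W, (hS W).2 ⟨⟨hpos, hWl⟩, hW, hl⟩, 0, rfl⟩
  -- Distinct initial words have disjoint orbits: a positive iterate of an initial word is longer
  -- than `L`, while initial words are not.
  have hinj : ∀ W ∈ S, ∀ W' ∈ S, ∀ k d, (opT σ)^[k] W = (opT σ)^[k + d] W' → W = W' ∧ d = 0 := by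
    intro W hW W' hW' k d he
    rw [Function.iterate_add_apply] at he
    have he' := (opT_injective hm).iterate k he
    cases d with
    | zero => exact ⟨he', rfl⟩
    | succ d =>
      have h1 := ((hS W).1 hW).1.2
      have h3 := ((hS W').1 hW').2.2
      have h4 := length_opT_le_iterate h2 W' d
      rw [← he'] at h4
      omega
  let K : Word → Finset ℕ+ := fun W =>
    if h : {k : ℕ+ | ((opT σ)^[(k : ℕ)] W).length = n}.Finite then h.toFinset else ∅
  have hK : ∀ W ∈ S, ∀ k, k ∈ K W ↔ ((opT σ)^[(k : ℕ)] W).length = n := by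
    intro W hW k
    simp [K, hfin W hW]
  have hset : {V : Word | V.length = n ∧ Q V} =
      ((S.sigma K).image fun x => (opT σ)^[(x.2 : ℕ)] x.1 : Finset Word) := by
    ext V
    simp only [Set.mem_ofPred_eq, Finset.coe_image, Set.mem_image, Finset.mem_coe, Finset.mem_sigma,
      Sigma.exists]
    constructor
    · rintro ⟨hl, hV⟩
      obtain ⟨W, hW, k, hk⟩ := hdesc _ V rfl hV (hl ▸ hn)
      refine ⟨W, k.succPNat, ⟨hW, (hK W hW _).2 ?_⟩, hk⟩
      rw [Nat.succPNat_coe, Nat.succ_eq_add_one, hk, hl]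
    · rintro ⟨W, k, ⟨hW, hk⟩, rfl⟩
      refine ⟨(hK W hW k).1 hk, ?_⟩
      have := hQk W hW k.natPred
      rwa [PNat.natPred_add_one] at this
  rw [hset, Set.ncard_coe_finset, Finset.card_image_of_injOn, Finset.card_sigma, Nat.cast_sum]
  · refine Finset.sum_congr rfl fun W hW => ?_
    rw [tsum_kron (hfin W hW)]
    simp [K, hfin W hW]
  · rintro ⟨W, k⟩ hk ⟨W', k'⟩ hk' he
    simp only [Finset.coe_sigma, Set.mem_sigma_iff, Finset.mem_coe] at hk hk' he
    rcases le_total (k : ℕ) k' with hle | hle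
    · obtain ⟨d, hd⟩ := Nat.exists_eq_add_of_le hle
      rw [hd] at he
      obtain ⟨rfl, rfl⟩ := hinj W hk.1 W' hk'.1 _ _ he
      obtain rfl : k = k' := PNat.eq (by omega)
      rfl
    · obtain ⟨d, hd⟩ := Nat.exists_eq_add_of_le hle
      rw [hd] at he
      obtain ⟨rfl, rfl⟩ := hinj W' hk'.1 W hk.1 _ _ he.symm
      obtain rfl : k = k' := PNat.eq (by omega)
      rfl

lemma finite_setOf_length_eq (n : ℕ) (Q : Word → Prop) : {W : Word | W.length = n ∧ Q W}.Finite :=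
  (List.finite_length_eq Letter n).subset fun _ h => h.1

/-- Words of length `n + 1` counted through an extension `e x` by one letter `x`. -/
lemma ncard_length_succ {e : Letter → Word → Word} (he : ∀ x, Function.Injective (e x))
    (hne : ∀ V V', e false V ≠ e true V') (hl : ∀ x V, (e x V).length = V.length + 1)
    (hsurj : ∀ U : Word, U ≠ [] → ∃ x V, U = e x V) (Q : Word → Prop) (n : ℕ) :
    {W : Word | W.length = n + 1 ∧ Q W}.ncard =
      {V : Word | V.length = n ∧ ∃ x, Q (e x V)}.ncard +
        {V : Word | V.length = n ∧ ∀ x, Q (e x V)}.ncard := by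
  have h1 : {W : Word | W.length = n + 1 ∧ Q W} =
      e false '' {V | V.length = n ∧ Q (e false V)} ∪
        e true '' {V | V.length = n ∧ Q (e true V)} := by
    ext W
    constructor
    · rintro ⟨hW, hQ⟩
      obtain ⟨x, V, rfl⟩ := hsurj W (by rintro rfl; simp at hW)
      rw [hl, Nat.add_right_cancel_iff] at hW
      cases x
      · exact Or.inl ⟨V, ⟨hW, hQ⟩, rfl⟩
      · exact Or.inr ⟨V, ⟨hW, hQ⟩, rfl⟩
    · rintro (⟨V, ⟨hV, hQ⟩, rfl⟩ | ⟨V, ⟨hV, hQ⟩, rfl⟩)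
      · exact ⟨by rw [hl, hV], hQ⟩
      · exact ⟨by rw [hl, hV], hQ⟩
  -- Inclusion–exclusion: words with some good extension count once, and those with two count once
  -- more.
  rw [h1, Set.ncard_union_eq _ ((finite_setOf_length_eq n _).image _)
    ((finite_setOf_length_eq n _).image _), Set.ncard_image_of_injective _ (he _),
    Set.ncard_image_of_injective _ (he _), ← Set.ncard_union_add_ncard_inter _ _
      (finite_setOf_length_eq n _) (finite_setOf_length_eq n _)]
  · congr 2
    · ext V
      simp only [Set.mem_union, Set.mem_ofPred_eq, Bool.exists_bool]
      tauto
    · ext V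
      simp only [Set.mem_inter_iff, Set.mem_ofPred_eq, Bool.forall_bool]
      tauto
  · rw [Set.disjoint_left]
    rintro _ ⟨V, -, rfl⟩ ⟨V', -, h⟩
    exact hne V V' h.symm

lemma exists_isFactor_append_iff {ξ : ℕ → Letter} {V : Word} :
    (∃ x, IsFactor ξ (V ++ [x])) ↔ IsFactor ξ V := by
  constructor
  · rintro ⟨x, hx⟩
    exact hx.of_infix ⟨[], [x], by simp⟩
  · rintro ⟨i, hi⟩
    exact ⟨_, isFactor_append_iff.2 ⟨i, hi, rfl⟩⟩

/-- Each factor of an infinite word extends to the right, and exactly the special ones do so twice.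
-/
lemma complexity_succ (ξ : ℕ → Letter) (n : ℕ) :
    complexity ξ (n + 1) = complexity ξ n + specialCount ξ n := by
  have h := ncard_length_succ (e := fun x V => V ++ [x]) (fun x => List.append_left_injective [x])
    (fun V V' h => by simpa using (List.append_inj' h rfl).2) (by simp)
    (fun U hU => ⟨U.getLast hU, U.dropLast, (List.dropLast_append_getLast hU).symm⟩)
    (IsFactor ξ) n
  simp only [exists_isFactor_append_iff] at h
  exact h

/-- Deleting the first letter keeps a word special, so special words of length `n + 1` are
prolongations of special words of length `n`: weak ones contribute none, strong ones two, the others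
one. -/
lemma specialCount_succ_add {ξ : ℕ → Letter} (n : ℕ) :
    specialCount ξ (n + 1) + {V : Word | V.length = n ∧ IsWeakSpecial ξ V}.ncard =
      specialCount ξ n + {V : Word | V.length = n ∧ IsStrongSpecial ξ V}.ncard := by
  have tail : ∀ {x V}, IsSpecial ξ (x :: V) → IsSpecial ξ V := fun {x V} h y =>
    (h y).of_infix ⟨[x], [], by simp⟩
  have h := ncard_length_succ (e := fun x V => x :: V) (fun x => List.cons_injective)
    (fun V V' h => by simp at h) (by simp)
    (fun U hU => ⟨U.head hU, U.tail, (List.cons_head_tail hU).symm⟩) (IsSpecial ξ) n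
  have h1 : {V : Word | V.length = n ∧ IsSpecial ξ V} =
      {V : Word | V.length = n ∧ ∃ x, IsSpecial ξ (x :: V)} ∪
        {V : Word | V.length = n ∧ IsWeakSpecial ξ V} := by
    ext V
    simp only [Set.mem_union, Set.mem_ofPred_eq, IsWeakSpecial]
    constructor
    · rintro ⟨hV, hs⟩
      by_cases hx : ∃ x, IsSpecial ξ (x :: V)
      · exact Or.inl ⟨hV, hx⟩
      · exact Or.inr ⟨hV, hs, not_exists.1 hx⟩
    · rintro (⟨hV, x, hx⟩ | ⟨hV, hs, -⟩)
      · exact ⟨hV, tail hx⟩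
      · exact ⟨hV, hs⟩
  have h2 : {V : Word | V.length = n ∧ ∀ x, IsSpecial ξ (x :: V)} =
      {V : Word | V.length = n ∧ IsStrongSpecial ξ V} := by
    ext V
    exact and_congr_right' ⟨fun hx => ⟨tail (hx false), hx⟩, fun hx => hx.2⟩
  rw [h2] at h
  rw [specialCount, specialCount, h, h1, Set.ncard_union_eq _ (finite_setOf_length_eq n _)
    (finite_setOf_length_eq n _)]
  · omega
  · rw [Set.disjoint_left]
    rintro V ⟨-, x, hx⟩ ⟨-, -, hw⟩
    exact hw x hx

lemma mem_shortWords {L : ℕ} {W : Word} : W ∈ shortWords L ↔ 1 ≤ W.length ∧ W.length ≤ L := by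
  simp [shortWords, and_comm]

lemma mem_shortSpecial {ξ : ℕ → Letter} {L : ℕ} {W : Word} :
    W ∈ shortSpecial ξ L ↔ (1 ≤ W.length ∧ W.length ≤ L) ∧ IsSpecial ξ W := by
  simp [shortSpecial, mem_shortWords]

lemma mem_initialStrong {σ : Substitution} {ξ : ℕ → Letter} {L : ℕ} {W : Word} :
    W ∈ initialStrong σ ξ L ↔
      (1 ≤ W.length ∧ W.length ≤ L) ∧ IsStrongSpecial ξ W ∧ L < (opT σ W).length := by
  simp [initialStrong, mem_shortWords]

lemma mem_initialWeak {σ : Substitution} {ξ : ℕ → Letter} {L : ℕ} {W : Word} :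
    W ∈ initialWeak σ ξ L ↔
      (1 ≤ W.length ∧ W.length ≤ L) ∧ IsWeakSpecial ξ W ∧ L < (opT σ W).length := by
  simp [initialWeak, mem_shortWords]

/-- The signed sum over the short special words is the difference of the sums over the initial
strong and the initial weak ones. -/
lemma sum_tsum_sgn_mul (σ : Substitution) (ξ : ℕ → Letter) (L n : ℕ) :
    ∑ W ∈ shortSpecial ξ L, ∑' k : ℕ+, sgn σ ξ L W * kron ((opT σ)^[(k : ℕ)] W).length n =
      (∑ W ∈ initialStrong σ ξ L, ∑' k : ℕ+, kron ((opT σ)^[(k : ℕ)] W).length n) -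
        ∑ W ∈ initialWeak σ ξ L, ∑' k : ℕ+, kron ((opT σ)^[(k : ℕ)] W).length n := by
  classical
  have hs : initialStrong σ ξ L ⊆ shortSpecial ξ L := fun W hW => by
    rw [mem_initialStrong] at hW
    rw [mem_shortSpecial]
    exact ⟨hW.1, hW.2.1.1⟩
  have hw : initialWeak σ ξ L ⊆ shortSpecial ξ L := fun W hW => by
    rw [mem_initialWeak] at hW
    rw [mem_shortSpecial]
    exact ⟨hW.1, hW.2.1.1⟩
  rw [← Finset.inter_eq_right.2 hs, ← Finset.inter_eq_right.2 hw, ← Finset.sum_ite_mem,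
    ← Finset.sum_ite_mem, ← Finset.sum_sub_distrib]
  refine Finset.sum_congr rfl fun W hW => ?_
  have hd : W ∈ initialWeak σ ξ L → W ∉ initialStrong σ ξ L := fun h h' => by
    rw [mem_initialWeak] at h
    rw [mem_initialStrong] at h'
    exact h.2.1.2 false (h'.2.1.2 false)
  by_cases h1 : W ∈ initialWeak σ ξ L
  · simp [sgn, h1, hd h1, tsum_neg]
  · by_cases h3 : W ∈ initialStrong σ ξ L <;> simp [sgn, h1, h3]

end BinarySubst

open BinarySubst in
theorem mainTheorem3 (σ : Substitution) (hmarked : IsWellMarked σ) (hprim : IsPrimitive σ) :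
    (∃ C : ℕ, ∀ ξ : ℕ → Letter, IsFixedPoint σ ξ → ¬ IsUltimatelyPeriodic ξ →
      IsRecognizabilityConstant σ ξ C) ∧
    ∀ ξ : ℕ → Letter, IsFixedPoint σ ξ → ¬ IsUltimatelyPeriodic ξ →
      (∀ n : ℕ, (specialCount ξ n : ℤ) = (complexity ξ (n + 1) : ℤ) - (complexity ξ n : ℤ)) ∧
      ∀ C : ℕ, IsRecognizabilityConstant σ ξ C → ∀ n : ℕ, threshold σ C < n →
        (∀ W ∈ shortSpecial ξ (threshold σ C),
          {k : ℕ+ | ((opT σ)^[(k : ℕ)] W).length = n}.Finite) ∧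
        (specialCount ξ (n + 1) : ℤ) - (specialCount ξ n : ℤ) =
          (∑ W ∈ initialStrong σ ξ (threshold σ C),
              ∑' k : ℕ+, kron ((opT σ)^[(k : ℕ)] W).length n) -
            ∑ W ∈ initialWeak σ ξ (threshold σ C),
              ∑' k : ℕ+, kron ((opT σ)^[(k : ℕ)] W).length n ∧
        (specialCount ξ (n + 1) : ℤ) - (specialCount ξ n : ℤ) =
          ∑ W ∈ shortSpecial ξ (threshold σ C),
            ∑' k : ℕ+, sgn σ ξ (threshold σ C) W * kron ((opT σ)^[(k : ℕ)] W).length n := by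
  have h2 := two_le_length hmarked hprim
  refine ⟨exists_uniform_isRecognizabilityConstant hmarked hprim, fun ξ h _ => ⟨fun n => ?_,
    fun C hC n hn => ?_⟩⟩
  · rw [complexity_succ]
    push_cast
    ring
  -- This is where the second term in the maximum defining the threshold is needed.
  have hL : lengthW0 σ ≤ threshold σ C := (lengthW0_le hmarked).trans (le_max_right _ _)
  have hstrong := ncard_eq_sum_tsum_kron hmarked hprim hL (Q := IsStrongSpecial ξ)
    (fun W hW hl => (h.isStrongSpecial_congr hmarked hprim
      (h.isFactor_iff_of_isBispecial hmarked hprim hC hl hW.isBispecial)).1 hW)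
    (fun V hV hl => by
      obtain ⟨W, hW, hE⟩ := h.exists_eq_opT_of_isBispecial hmarked hprim hC hl hV.isBispecial
      exact ⟨W, hW, (h.isStrongSpecial_congr hmarked hprim hE).2 hV⟩)
    (fun W => mem_initialStrong) hn
  have hweak := ncard_eq_sum_tsum_kron hmarked hprim hL (Q := IsWeakSpecial ξ)
    (fun W hW hl => (h.isWeakSpecial_congr hmarked hprim
      (h.isFactor_iff_of_isBispecial hmarked hprim hC hl
        (h.isBispecial_of_isWeakSpecial hmarked hprim hW))).1 hW)
    (fun V hV hl => by
      obtain ⟨W, hW, hE⟩ := h.exists_eq_opT_of_isBispecial hmarked hprim hC hl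
        (h.isBispecial_of_isWeakSpecial hmarked hprim hV)
      exact ⟨W, hW, (h.isWeakSpecial_congr hmarked hprim hE).2 hV⟩)
    (fun W => mem_initialWeak) hn
  have hcount := specialCount_succ_add (ξ := ξ) n
  rw [sum_tsum_sgn_mul, ← hstrong, ← hweak]
  exact ⟨fun W hW => finite_setOf_length_iterate_eq h2 (mem_shortSpecial.1 hW).1.1 n,
    by omega, by omega⟩
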